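/- Let $(Y_i)_{i\ge 1}$ and $(Z_i)_{i\ge 1}$ be real-valued stochastic processes on a common probability space, let $\lambda\in[0,1]$, and for $n\in\mathbb N$ put $\ell=\lfloor\lambda n\rfloor$ and $\mathbf x^{(n)}=[X_1\,\dots\,X_n]^{\mathsf T}=[Y_1\,\dots\,Y_{n-\ell}\;Z_1\,\dots\,Z_\ell]^{\mathsf T}$. Suppose that for each $n$ the entries $X_1,\dots,X_n$ of $\mathbf x^{(n)}$ are independent, that $X_i$ has the distribution $(1-\rho_1)\mu_{\mathrm d_1}+\rho_1\mu_{\mathrm c_1}$ for $1\le i\le n-\ell$ and the distribution $(1-\rho_2)\mu_{\mathrm d_2}+\rho_2\mu_{\mathrm c_2}$ for $n-\ell<i\le n$, where $\rho_1,\rho_2\in[0,1]$, the $\mu_{\mathrm d_j}$ are discrete probability distributions on $\mathbb R$, and the $\mu_{\mathrm c_j}$ are probability distributions on $\mathbb R$ that are absolutely continuous with respect to Lebesgue measure (none of which depends on $n$). For a nonempty bounded set $S\subseteq\mathbb R^n$ let $N_S(\delta)$ be the least number of open Euclidean balls of radius $\delta$ needed to cover $S$, and let $$\underline{\dim}_{\mathrm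 B}(S)=\liminf_{\delta\to0}\frac{\log N_S(\delta)}{\log(1/\delta)},\qquad \overline{\dim}_{\mathrm B}(S)=\limsup_{\delta\to0}\frac{\log N_S(\delta)}{\log(1/\delta)}$$ be its lower and upper Minkowski dimension. For $\varepsilon>0$ define the lower and upper Minkowski dimension compression rates by $$\underline R_{\mathrm B}(\varepsilon)=\limsup_{n\to\infty}\ \inf_{S}\frac{\underline{\dim}_{\mathrm B}(S)}{n},\qquad \overline R_{\mathrm B}(\varepsilon)=\limsup_{n\to\infty}\ \inf_{S}\frac{\overline{\dim}_{\mathrm B}(S)}{n},$$ where both infima are over all nonempty bounded Borel sets $S\subseteq\mathbb R^n$ with $\mathbb P[\mathbf x^{(n)}\in S]\ge 1-\varepsilon$. When the two rates coincide, their common value is the Minkowski dimension compression rate $R_{\mathrm B}(\varepsilon)$. Then for every $\varepsilon\in(0,1)$ the two rates coincide, and $$R_{\mathrm B}(\varepsilon)=(1-\lambda)\rho_1+\lambda\rho_2 .$$ -/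

import Mathlib

open Filter Topology MeasureTheory ProbabilityTheory

namespace SignalSeparation

/-- Covering number `N_S(δ)`: the least number of open Euclidean balls of radius `δ`,
with arbitrary centers in `ℝⁿ`, whose union contains `S`. (For bounded `S` and `δ > 0` the set of
admissible `m` is nonempty.) -/
noncomputable def coveringNumber {n : ℕ} (S : Set (EuclideanSpace ℝ (Fin n))) (δ : ℝ) : ℕ :=
  sInf {m : ℕ | ∃ x : Fin m → EuclideanSpace ℝ (Fin n), S ⊆ ⋃ i, Metric.ball (x i) δ}

/-- The quotient `log N_S(δ) / log (1/δ)`, as an extended real number. -/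
noncomputable def coveringExponent {n : ℕ} (S : Set (EuclideanSpace ℝ (Fin n))) (δ : ℝ) : EReal :=
  ((Real.log (coveringNumber S δ) / Real.log (1 / δ) : ℝ) : EReal)

/-- Lower Minkowski (box-counting) dimension of a nonempty bounded set `S ⊆ ℝⁿ`. -/
noncomputable def lowerMinkowskiDim {n : ℕ} (S : Set (EuclideanSpace ℝ (Fin n))) : EReal :=
  liminf (fun δ : ℝ => coveringExponent S δ) (𝓝[>] 0)

/-- Upper Minkowski (box-counting) dimension of a nonempty bounded set `S ⊆ ℝⁿ`. -/
noncomputable def upperMinkowskiDim {n : ℕ} (S : Set (EuclideanSpace ℝ (Fin n))) : EReal :=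
  limsup (fun δ : ℝ => coveringExponent S δ) (𝓝[>] 0)

variable {Ω : Type*} [MeasurableSpace Ω]

/-- The number `ℓ = ⌊lam * n⌋` of components taken from the second process. -/
noncomputable def numZ (lam : ℝ) (n : ℕ) : ℕ := ⌊lam * n⌋₊

/-- The concatenated source vector of dimension `n`: its first `n - ℓ` entries are the first
`n - ℓ` members of the process `Y`, its last `ℓ` entries are the first `ℓ` members of `Z`
(all indices start at `0`). -/
noncomputable def concatSource (lam : ℝ) (Y Z : ℕ → Ω → ℝ) (n : ℕ) (ω : Ω) :
    EuclideanSpace ℝ (Fin n) :=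
  WithLp.toLp 2 fun i : Fin n =>
    if (i : ℕ) < n - numZ lam n then Y i ω else Z (i - (n - numZ lam n)) ω

/-- The approximate support sets over which the compression rates are optimized: the nonempty
bounded (measurable) sets `S ⊆ ℝⁿ` with `ℙ[x ∈ S] ≥ 1 - ε`. -/
def approxSupports {n : ℕ} (P : Measure Ω) (x : Ω → EuclideanSpace ℝ (Fin n)) (ε : ℝ) :
    Set (Set (EuclideanSpace ℝ (Fin n))) :=
  {S | S.Nonempty ∧ Bornology.IsBounded S ∧ MeasurableSet S ∧
    ENNReal.ofReal (1 - ε) ≤ P {ω | x ω ∈ S}}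

/-- Lower Minkowski dimension compression rate of a sequence of random vectors `x n` in `ℝⁿ`:
the limit superior of the infima of the normalized lower dimensions. -/
noncomputable def lowerMinkowskiRate (P : Measure Ω)
    (x : (n : ℕ) → Ω → EuclideanSpace ℝ (Fin n)) (ε : ℝ) : EReal :=
  limsup (fun n : ℕ => ⨅ S ∈ approxSupports P (x n) ε, lowerMinkowskiDim S / (n : EReal)) atTop

/-- Upper Minkowski dimension compression rate of a sequence of random vectors `x n` in `ℝⁿ`:
the limit superior of the infima of the normalized upper dimensions. -/
noncomputable def upperMinkowskiRate (P : Measure Ω)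
    (x : (n : ℕ) → Ω → EuclideanSpace ℝ (Fin n)) (ε : ℝ) : EReal :=
  limsup (fun n : ℕ => ⨅ S ∈ approxSupports P (x n) ε, upperMinkowskiDim S / (n : EReal)) atTop

/-- `r` is the Minkowski dimension compression rate `R_B(ε)`: the lower and the upper rate coincide
and their common value is `r`. -/
def IsMinkowskiRate (P : Measure Ω) (x : (n : ℕ) → Ω → EuclideanSpace ℝ (Fin n)) (ε r : ℝ) : Prop :=
  lowerMinkowskiRate P x ε = (r : EReal) ∧ upperMinkowskiRate P x ε = (r : EReal)

/-- A discrete distribution on `ℝ`: a probability measure carried by a countable set. -/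
def IsDiscreteDistribution (μ : Measure ℝ) : Prop :=
  IsProbabilityMeasure μ ∧ ∃ C : Set ℝ, C.Countable ∧ μ Cᶜ = 0

/-- An absolutely continuous distribution on `ℝ`. -/
def IsContinuousDistribution (μ : Measure ℝ) : Prop :=
  IsProbabilityMeasure μ ∧ μ ≪ volume

/-- The measure `μ` is a mixture `(1 - ρ) μd + ρ μc` of a discrete and an absolutely continuous
distribution, with mixture parameter `ρ ∈ [0, 1]`. -/
def IsMixedDistribution (ρ : ℝ) (μ : Measure ℝ) : Prop :=
  0 ≤ ρ ∧ ρ ≤ 1 ∧ ∃ μd μc : Measure ℝ, IsDiscreteDistribution μd ∧ IsContinuousDistribution μc ∧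
    μ = ENNReal.ofReal (1 - ρ) • μd + ENNReal.ofReal ρ • μc

/-- The concatenated source has a mixed discrete-continuous distribution with mixture parameters
`ρ₁` and `ρ₂`: for each `n` the entries of the source vector are independent, its first `n - ℓ`
entries have a common mixed law `μ₁` with parameter `ρ₁`, and its last `ℓ` entries have a common
mixed law `μ₂` with parameter `ρ₂`. -/
def IsMixedSource (P : Measure Ω) (lam ρ₁ ρ₂ : ℝ) (Y Z : ℕ → Ω → ℝ) : Prop :=
  ∃ μ₁ μ₂ : Measure ℝ, IsMixedDistribution ρ₁ μ₁ ∧ IsMixedDistribution ρ₂ μ₂ ∧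
    ∀ n : ℕ, iIndepFun (fun (i : Fin n) (ω : Ω) => concatSource lam Y Z n ω i) P ∧
      ∀ i : Fin n, P.map (fun ω => concatSource lam Y Z n ω i) =
        if (i : ℕ) < n - numZ lam n then μ₁ else μ₂

end SignalSeparation

namespace SignalSeparation

/-! Write `r = (1 - lam) * ρ₁ + lam * ρ₂`. By Chebyshev, about `n * r` of the `n` coordinates come
from the continuous parts, up to an error `n * η`, with probability tending to `1`. Each such
coordinate costs one dimension; the others are nearly confined to a finite set and cost none.

Lower bound: discarding mass `η`, each continuous part lives on a set where the law has bounded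
density (`exists_bounded_density`). A ball of radius `δ` catches `k` given coordinates in these sets
with probability at most `(M * δ) ^ k`. A set of probability at least `1 - ε` therefore needs at
least a constant times `(1 / δ) ^ k` balls, with `k` close to `n * r`
(`le_lowerMinkowskiDim_of_measure`).

Upper bound: a finite set carries each discrete part up to mass `η` (`exists_finset`). With high
probability the source vector lies in a cube and at most `k ≈ n * r` coordinates avoid these finite
sets. Such vectors form finitely many pieces of dimension at most `k`
(`upperMinkowskiDim_sparseBox_le`).

The dimension bounds are for fixed `n`, so their constants may depend on `n` arbitrarily. -/

/-! ### Concentration of counts and truncation of mixed laws -/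

/-- Chebyshev's inequality for the number of independent events that occur. -/
theorem measure_count_deviation_le {Ω : Type*} [MeasurableSpace Ω] {P : Measure Ω}
    [IsProbabilityMeasure P] {n : ℕ} {X : Fin n → Ω → ℝ} (hX : ∀ i, Measurable (X i))
    (hind : iIndepFun X P) {s : Fin n → Set ℝ} (hs : ∀ i, MeasurableSet (s i))
    {t : ℝ} (ht : 0 < t) :
    P {ω | t ≤ |∑ i, (s i).indicator (1 : ℝ → ℝ) (X i ω) - ∑ i, P.real (X i ⁻¹' s i)|} ≤
      ENNReal.ofReal (n / t ^ 2) := by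
  have hg : ∀ i, Measurable ((s i).indicator (1 : ℝ → ℝ)) := fun i =>
    measurable_one.indicator (hs i)
  set f : Fin n → Ω → ℝ := fun i ω => (s i).indicator (1 : ℝ → ℝ) (X i ω) with hf
  have hfm : ∀ i, Measurable (f i) := fun i => (hg i).comp (hX i)
  have hfb : ∀ i ω, f i ω ∈ Set.Icc (0 : ℝ) 1 := by
    intro i ω
    by_cases h : X i ω ∈ s i <;> simp [hf, h]
  have hL : ∀ i, MemLp (f i) 2 P := fun i =>
    MemLp.of_bound (hfm i).aestronglyMeasurable 1 (ae_of_all _ fun ω => by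
      have := hfb i ω
      rw [Real.norm_eq_abs, abs_le]
      exact ⟨by linarith [this.1], this.2⟩)
  have hfind : iIndepFun f P := hind.comp (fun i => (s i).indicator (1 : ℝ → ℝ)) hg
  have hmean : ∀ i, ∫ ω, f i ω ∂P = P.real (X i ⁻¹' s i) := by
    intro i
    have : f i = (X i ⁻¹' s i).indicator 1 := by
      ext ω
      by_cases h : X i ω ∈ s i
      · rw [Set.indicator_of_mem (show ω ∈ X i ⁻¹' s i from h)]
        simp [hf, h]
      · rw [Set.indicator_of_notMem (show ω ∉ X i ⁻¹' s i from h)]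
        simp [hf, h]
    rw [this, integral_indicator_one ((hX i) (hs i))]
  have hvar : Var[∑ i, f i; P] ≤ n := by
    rw [IndepFun.variance_sum (fun i _ => hL i)
      (fun i _ j _ hij => hfind.indepFun hij)]
    calc ∑ i, Var[f i; P] ≤ ∑ _i : Fin n, (1 : ℝ) := by
          refine Finset.sum_le_sum fun i _ => ?_
          refine (variance_le_sq_of_bounded (ae_of_all _ (hfb i)) (hfm i).aemeasurable).trans ?_
          norm_num
      _ = n := by simp
  have hE : P[∑ i, f i] = ∑ i, P.real (X i ⁻¹' s i) := by
    simp only [Finset.sum_apply]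
    rw [integral_finsetSum _ fun i _ => (hL i).integrable (by norm_num)]
    exact Finset.sum_congr rfl fun i _ => hmean i
  have hch := meas_ge_le_variance_div_sq (memLp_finsetSum' Finset.univ fun i _ => hL i) ht
  rw [hE] at hch
  simp only [Finset.sum_apply] at hch
  refine hch.trans (ENNReal.ofReal_le_ofReal ?_)
  gcongr

/-- Up to mass `η`, the continuous part of a mixed distribution is carried by a set on which the
distribution has bounded density. -/
theorem IsMixedDistribution.exists_bounded_density {ρ : ℝ} {μ : Measure ℝ}
    (h : IsMixedDistribution ρ μ) {η : ℝ} (hη : 0 < η) :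
    ∃ (G : Set ℝ) (M : ℝ), MeasurableSet G ∧ 0 < M ∧ ρ - η ≤ μ.real G ∧
      ∀ a δ : ℝ, 0 < δ → μ (G ∩ Metric.ball a δ) ≤ ENNReal.ofReal (M * δ) := by
  obtain ⟨h0, h1, μd, μc, ⟨hdp, C, hC, hCd⟩, ⟨hcp, hac⟩, rfl⟩ := h
  have hCc : μc C = 0 := hac (hC.measure_zero volume)
  let f := μc.rnDeriv volume
  have hfm : Measurable f := Measure.measurable_rnDeriv _ _
  let A : ℕ → Set ℝ := fun m => {x | f x ≤ m}
  have hA : ∀ m, MeasurableSet (A m) := fun m => hfm measurableSet_Iic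
  have hmono : Monotone A := fun m m' hmm x (hx : f x ≤ m) =>
    hx.trans (by exact_mod_cast hmm)
  have hunion : μc (⋃ m, A m) = 1 := by
    have : ∀ᵐ x ∂μc, x ∈ ⋃ m, A m := by
      filter_upwards [hac.ae_le (Measure.rnDeriv_lt_top μc volume)] with x hx
      obtain ⟨m, hm⟩ := ENNReal.exists_nat_gt hx.ne
      exact Set.mem_iUnion.2 ⟨m, hm.le⟩
    exact (prob_compl_eq_zero_iff (MeasurableSet.iUnion hA)).1 (mem_ae_iff.1 this)
  have hlim : Tendsto (fun m => μc.real (A m)) atTop (𝓝 1) := by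
    have := tendsto_measure_iUnion_atTop (μ := μc) hmono
    rw [hunion] at this
    exact (ENNReal.tendsto_toReal ENNReal.one_ne_top).comp this
  obtain ⟨m, hm⟩ := (hlim.eventually (lt_mem_nhds (show 1 - η < 1 by linarith))).exists
  have hd0 : ∀ B : Set ℝ, μd ((A m \ C) ∩ B) = 0 := fun B =>
    measure_mono_null (fun x hx => hx.1.2) hCd
  -- Removing `C` kills the discrete part. The density is at most `m` on an interval of length `2 *
  -- δ`; the extra `1` keeps the constant positive when `m = 0`.
  refine ⟨A m \ C, 2 * m + 1, (hA m).diff hC.measurableSet, by positivity, ?_, ?_⟩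
  · have hd := hd0 Set.univ
    rw [Set.inter_univ] at hd
    have : μc.real (A m \ C) = μc.real (A m) := by
      simp only [Measure.real, measure_sdiff_null hCc]
    rw [Measure.real, Measure.add_apply, Measure.smul_apply, Measure.smul_apply, hd]
    simp only [smul_eq_mul, mul_zero, zero_add, ENNReal.toReal_mul, ENNReal.toReal_ofReal h0]
    change ρ - η ≤ ρ * μc.real (A m \ C)
    rw [this]
    nlinarith
  · intro a δ hδ
    rw [Measure.add_apply, Measure.smul_apply, Measure.smul_apply, hd0]
    simp only [smul_eq_mul, mul_zero, zero_add]
    have h2 : μc (A m ∩ Metric.ball a (δ)) ≤ m * ENNReal.ofReal (2 * δ) := by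
      rw [← Measure.withDensity_rnDeriv_eq μc volume hac,
        withDensity_apply _ ((hA m).inter measurableSet_ball), ← Real.volume_ball]
      calc ∫⁻ x in A m ∩ Metric.ball a δ, f x
          ≤ ∫⁻ _x in A m ∩ Metric.ball a δ, (m : ENNReal) :=
            setLIntegral_mono measurable_const fun x hx => hx.1
        _ = m * volume (A m ∩ Metric.ball a δ) := by simp
        _ ≤ m * volume (Metric.ball a δ) := by gcongr; exact Set.inter_subset_right
    have h3 : μc ((A m \ C) ∩ Metric.ball a δ) ≤ ENNReal.ofReal ((2 * m + 1) * δ) := by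
      refine (measure_mono (Set.inter_subset_inter_left _ Set.sdiff_subset)).trans (h2.trans ?_)
      rw [← ENNReal.ofReal_natCast, ← ENNReal.ofReal_mul (by positivity)]
      exact ENNReal.ofReal_le_ofReal (by nlinarith)
    exact (mul_le_of_le_one_left' (ENNReal.ofReal_le_one.2 h1)).trans h3

/-- Up to mass `η`, the discrete part of a mixed distribution is carried by a finite set. -/
theorem IsMixedDistribution.exists_finset {ρ : ℝ} {μ : Measure ℝ}
    (h : IsMixedDistribution ρ μ) {η : ℝ} (hη : 0 < η) :
    ∃ F : Finset ℝ, μ.real (F : Set ℝ)ᶜ ≤ ρ + η := by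
  obtain ⟨h0, h1, μd, μc, ⟨hdp, C, hC, hCd⟩, ⟨hcp, hac⟩, rfl⟩ := h
  -- The point `0` is added only so that the countable set, being nonempty, is the range of a
  -- sequence.
  have hne : (C ∪ {0}).Nonempty := ⟨0, by simp⟩
  obtain ⟨g, hg⟩ := (hC.union (Set.countable_singleton 0)).exists_eq_range hne
  let A : ℕ → Finset ℝ := fun m => (Finset.range m).image g
  have hmono : Monotone fun m => (A m : Set ℝ) := fun m m' hmm =>
    Finset.coe_subset.2 (Finset.image_subset_image (Finset.range_mono hmm))
  have hunion : μd (⋃ m, (A m : Set ℝ)) = 1 := by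
    have hCA : C ⊆ ⋃ m, (A m : Set ℝ) := by
      intro x hx
      have : x ∈ Set.range g := hg ▸ Or.inl hx
      obtain ⟨j, rfl⟩ := this
      exact Set.mem_iUnion.2 ⟨j + 1, by
        simp only [A, Finset.coe_image]
        exact ⟨j, by simp, rfl⟩⟩
    have h1 : μd C = 1 := (prob_compl_eq_zero_iff hC.measurableSet).1 hCd
    exact le_antisymm prob_le_one (h1 ▸ measure_mono hCA)
  have hlim : Tendsto (fun m => μd.real (A m : Set ℝ)) atTop (𝓝 1) := by
    have := tendsto_measure_iUnion_atTop (μ := μd) hmono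
    rw [hunion] at this
    exact (ENNReal.tendsto_toReal ENNReal.one_ne_top).comp this
  obtain ⟨m, hm⟩ := (hlim.eventually (lt_mem_nhds (show 1 - η < 1 by linarith))).exists
  refine ⟨A m, ?_⟩
  have hd : μd.real (A m : Set ℝ)ᶜ ≤ η := by
    rw [probReal_compl_eq_one_sub (A m).measurableSet]
    linarith
  have hc : μc.real (A m : Set ℝ)ᶜ ≤ 1 := measureReal_le_one
  have : (ENNReal.ofReal (1 - ρ) • μd + ENNReal.ofReal ρ • μc).real (A m : Set ℝ)ᶜ =
      (1 - ρ) * μd.real (A m : Set ℝ)ᶜ + ρ * μc.real (A m : Set ℝ)ᶜ := by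
    have := Measure.smul_finite μd (ENNReal.ofReal_ne_top (r := 1 - ρ))
    have := Measure.smul_finite μc (ENNReal.ofReal_ne_top (r := ρ))
    rw [measureReal_add_apply]
    simp [measureReal_ennreal_smul_apply, h0, h1]
  rw [this]
  nlinarith [measureReal_nonneg (μ := μd) (s := (A m : Set ℝ)ᶜ)]

/-! ### Covering numbers and Minkowski dimensions -/

theorem coveringNumber_le_card {n : ℕ} {S : Set (EuclideanSpace ℝ (Fin n))} {δ : ℝ}
    (D : Finset (EuclideanSpace ℝ (Fin n))) (h : S ⊆ ⋃ x ∈ D, Metric.ball x δ) :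
    coveringNumber S δ ≤ D.card := by
  refine Nat.sInf_le ⟨fun i => (D.equivFin.symm i : EuclideanSpace ℝ (Fin n)), fun y hy => ?_⟩
  obtain ⟨x, hx, hyx⟩ := Set.mem_iUnion₂.1 (h hy)
  exact Set.mem_iUnion.2 ⟨D.equivFin ⟨x, hx⟩, by simpa using hyx⟩

/-- Boundedness gives total boundedness, so the infimum is over a nonempty set and is attained;
otherwise `sInf ∅ = 0` would be a spurious value. -/
theorem exists_cover_coveringNumber {n : ℕ} {S : Set (EuclideanSpace ℝ (Fin n))} {δ : ℝ}
    (hS : Bornology.IsBounded S) (hδ : 0 < δ) :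
    ∃ x : Fin (coveringNumber S δ) → EuclideanSpace ℝ (Fin n),
      S ⊆ ⋃ i, Metric.ball (x i) δ := by
  have hne : {m : ℕ | ∃ x : Fin m → EuclideanSpace ℝ (Fin n),
      S ⊆ ⋃ i, Metric.ball (x i) δ}.Nonempty := by
    obtain ⟨t, ht, hSt⟩ := Metric.totallyBounded_iff.1 (hS.isCompact_closure.totallyBounded.subset
      subset_closure) δ hδ
    refine ⟨ht.toFinset.card, fun i => (ht.toFinset.equivFin.symm i : EuclideanSpace ℝ (Fin n)),
      fun y hy => ?_⟩
    obtain ⟨x, hx, hyx⟩ := Set.mem_iUnion₂.1 (hSt hy)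
    exact Set.mem_iUnion.2 ⟨ht.toFinset.equivFin ⟨x, ht.mem_toFinset.2 hx⟩, by simpa using hyx⟩
  exact Nat.sInf_mem hne

/-- The quotient equals `log c / log (1 / δ) + k`, so multiplicative constants do not affect the
dimension. -/
theorem tendsto_log_mul_pow_div_log {c : ℝ} (hc : 0 < c) (k : ℕ) :
    Tendsto (fun δ : ℝ => ((Real.log (c * (1 / δ) ^ k) / Real.log (1 / δ) : ℝ) : EReal))
      (𝓝[>] 0) (𝓝 (k : EReal)) := by
  have hlog : Tendsto (fun δ : ℝ => Real.log (1 / δ)) (𝓝[>] 0) atTop := by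
    simp only [one_div]
    exact Real.tendsto_log_atTop.comp tendsto_inv_nhdsGT_zero
  have h1 : Tendsto (fun δ : ℝ => Real.log c / Real.log (1 / δ) + k) (𝓝[>] 0) (𝓝 (0 + k)) :=
    (tendsto_const_nhds.div_atTop hlog).add tendsto_const_nhds
  rw [zero_add] at h1
  have h2 : Tendsto (fun δ : ℝ => Real.log (c * (1 / δ) ^ k) / Real.log (1 / δ)) (𝓝[>] 0)
      (𝓝 (k : ℝ)) := by
    refine h1.congr' ?_
    filter_upwards [hlog.eventually_gt_atTop 0, self_mem_nhdsWithin] with δ hδ hδ0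
    have : (0 : ℝ) < δ := hδ0
    rw [Real.log_mul hc.ne' (by positivity), Real.log_pow]
    field_simp
  have h3 := (continuous_coe_real_ereal.tendsto (k : ℝ)).comp h2
  rwa [EReal.coe_natCast] at h3

theorem le_lowerMinkowskiDim {n : ℕ} {S : Set (EuclideanSpace ℝ (Fin n))} {c : ℝ} (hc : 0 < c)
    {k : ℕ} (h : ∀ δ : ℝ, 0 < δ → c * (1 / δ) ^ k ≤ coveringNumber S δ) :
    (k : EReal) ≤ lowerMinkowskiDim S := by
  rw [← (tendsto_log_mul_pow_div_log hc k).liminf_eq]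
  refine liminf_le_liminf ?_
  filter_upwards [Ioo_mem_nhdsGT (zero_lt_one' ℝ)] with δ hδ
  have h0 : 0 < δ := hδ.1
  have hl : 0 ≤ Real.log (1 / δ) := Real.log_nonneg (by rw [le_div_iff₀ h0]; linarith [hδ.2])
  refine EReal.coe_le_coe_iff.2 (div_le_div_of_nonneg_right (Real.log_le_log (by positivity)
    (h δ h0)) hl)

theorem upperMinkowskiDim_le {n : ℕ} {S : Set (EuclideanSpace ℝ (Fin n))} {c : ℝ} (hc : 1 ≤ c)
    {k : ℕ} (h : ∀ δ : ℝ, 0 < δ → δ < 1 → coveringNumber S δ ≤ c * (1 / δ) ^ k) :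
    upperMinkowskiDim S ≤ k := by
  rw [← (tendsto_log_mul_pow_div_log (zero_lt_one.trans_le hc) k).limsup_eq]
  refine limsup_le_limsup ?_
  filter_upwards [Ioo_mem_nhdsGT (zero_lt_one' ℝ)] with δ hδ
  have h0 : 0 < δ := hδ.1
  have h1 : 1 ≤ 1 / δ := by rw [le_div_iff₀ h0]; linarith [hδ.2]
  have hl : 0 ≤ Real.log (1 / δ) := Real.log_nonneg h1
  refine EReal.coe_le_coe_iff.2 (div_le_div_of_nonneg_right ?_ hl)
  -- A zero covering number needs care, since `Real.log 0 = 0` falls outside the monotonicity of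
  -- `log`.
  rcases Nat.eq_zero_or_pos (coveringNumber S δ) with h2 | h2
  · rw [h2, Nat.cast_zero, Real.log_zero]
    exact Real.log_nonneg (one_le_mul_of_one_le_of_one_le hc (one_le_pow₀ h1))
  · exact Real.log_le_log (by exact_mod_cast h2) (h δ h0 hδ.2)

theorem lowerMinkowskiDim_le_upperMinkowskiDim {n : ℕ} (S : Set (EuclideanSpace ℝ (Fin n))) :
    lowerMinkowskiDim S ≤ upperMinkowskiDim S :=
  liminf_le_limsup

/-! ### Lower bound: mass distribution -/

/-- The event that a vector lies in `S` and at least `k` of its independent coordinates lie in sets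
of bounded density is controlled by the covering number of `S`. -/
theorem measure_mem_inter_count_le {Ω : Type*} [MeasurableSpace Ω] {P : Measure Ω}
    {n : ℕ} {x : Ω → EuclideanSpace ℝ (Fin n)}
    (hind : iIndepFun (fun (i : Fin n) ω => x ω i) P)
    {G : Fin n → Set ℝ} (hG : ∀ i, MeasurableSet (G i)) {M : ℝ} (hM : 0 < M)
    (hGM : ∀ i a δ, 0 < δ →
      P ((fun ω => x ω i) ⁻¹' (G i ∩ Metric.ball a δ)) ≤ ENNReal.ofReal (M * δ))
    {S : Set (EuclideanSpace ℝ (Fin n))} (hS : Bornology.IsBounded S) (k : ℕ)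
    {δ : ℝ} (hδ : 0 < δ) :
    P {ω | x ω ∈ S ∧ (k : ℝ) ≤ ∑ i, (G i).indicator (1 : ℝ → ℝ) (x ω i)} ≤
      ENNReal.ofReal (coveringNumber S δ * (n.choose k * (M * δ) ^ k)) := by
  classical
  obtain ⟨y, hy⟩ := exists_cover_coveringNumber hS hδ
  -- Union bound over the ball of the cover containing `x ω` and over the `k` coordinates in the
  -- good sets; a ball projects into an interval of the same radius on every axis.
  have hsub : {ω | x ω ∈ S ∧ (k : ℝ) ≤ ∑ i, (G i).indicator (1 : ℝ → ℝ) (x ω i)} ⊆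
      ⋃ j, ⋃ T ∈ Finset.powersetCard k (Finset.univ : Finset (Fin n)),
        ⋂ i ∈ T, (fun ω => x ω i) ⁻¹' (G i ∩ Metric.ball (y j i) δ) := by
    rintro ω ⟨hωS, hω⟩
    obtain ⟨j, hj⟩ := Set.mem_iUnion.1 (hy hωS)
    have hcard : k ≤ (Finset.univ.filter fun i => x ω i ∈ G i).card := by
      have : ∑ i, (G i).indicator (1 : ℝ → ℝ) (x ω i) =
          ((Finset.univ.filter fun i => x ω i ∈ G i).card : ℝ) := by
        simp [Set.indicator_apply]
      rw [this] at hω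
      exact_mod_cast hω
    obtain ⟨T, hT, hTk⟩ := Finset.exists_subset_card_eq hcard
    simp only [Set.mem_iUnion, Set.mem_iInter]
    refine ⟨j, T, Finset.mem_powersetCard.2 ⟨Finset.subset_univ _, hTk⟩, fun i hi => ?_⟩
    refine ⟨(Finset.mem_filter.1 (hT hi)).2, ?_⟩
    rw [Metric.mem_ball, dist_eq_norm] at hj ⊢
    exact (PiLp.norm_apply_le (x ω - y j) i).trans_lt hj
  refine (measure_mono hsub).trans ((measure_iUnion_fintype_le _ _).trans ?_)
  have hterm : ∀ j, P (⋃ T ∈ Finset.powersetCard k (Finset.univ : Finset (Fin n)),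
        ⋂ i ∈ T, (fun ω => x ω i) ⁻¹' (G i ∩ Metric.ball (y j i) δ)) ≤
      ENNReal.ofReal (n.choose k * (M * δ) ^ k) := by
    intro j
    refine (measure_biUnion_finset_le _ _).trans ?_
    calc ∑ T ∈ Finset.powersetCard k (Finset.univ : Finset (Fin n)),
          P (⋂ i ∈ T, (fun ω => x ω i) ⁻¹' (G i ∩ Metric.ball (y j i) δ))
        ≤ ∑ T ∈ Finset.powersetCard k (Finset.univ : Finset (Fin n)),
          ENNReal.ofReal ((M * δ) ^ k) := by
          refine Finset.sum_le_sum fun T hT => ?_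
          rw [hind.measure_inter_preimage_eq_mul T
            fun i _ => (hG i).inter measurableSet_ball]
          refine (Finset.prod_le_prod' fun i _ => hGM i (y j i) δ hδ).trans ?_
          rw [Finset.prod_const, (Finset.mem_powersetCard.1 hT).2,
            ENNReal.ofReal_pow (by positivity)]
      _ = ENNReal.ofReal (n.choose k * (M * δ) ^ k) := by
          rw [Finset.sum_const, Finset.card_powersetCard, Finset.card_univ, Fintype.card_fin,
            nsmul_eq_mul, ENNReal.ofReal_mul (by positivity), ENNReal.ofReal_natCast]
  refine (Finset.sum_le_sum fun j _ => hterm j).trans ?_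
  rw [Finset.sum_const, Finset.card_univ, Fintype.card_fin, nsmul_eq_mul,
    ENNReal.ofReal_mul (p := (coveringNumber S δ : ℝ)) (Nat.cast_nonneg _), ENNReal.ofReal_natCast]

/-- A mass distribution principle for random vectors with independent coordinates. -/
theorem le_lowerMinkowskiDim_of_measure {Ω : Type*} [MeasurableSpace Ω] {P : Measure Ω}
    {n : ℕ} {x : Ω → EuclideanSpace ℝ (Fin n)}
    (hind : iIndepFun (fun (i : Fin n) ω => x ω i) P)
    {G : Fin n → Set ℝ} (hG : ∀ i, MeasurableSet (G i)) {M : ℝ} (hM : 0 < M)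
    (hGM : ∀ i a δ, 0 < δ →
      P ((fun ω => x ω i) ⁻¹' (G i ∩ Metric.ball a δ)) ≤ ENNReal.ofReal (M * δ))
    {S : Set (EuclideanSpace ℝ (Fin n))} (hS : Bornology.IsBounded S) {k : ℕ} {p q : ℝ}
    (hq : 0 ≤ q) (hqp : q < p) (hp : ENNReal.ofReal p ≤ P {ω | x ω ∈ S})
    (hcount : P {ω | ¬ (k : ℝ) ≤ ∑ i, (G i).indicator (1 : ℝ → ℝ) (x ω i)} ≤
      ENNReal.ofReal q) :
    (k : EReal) ≤ lowerMinkowskiDim S := by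
  have hpq : 0 < p - q := by linarith
  -- The constant solves `p ≤ N * choose * (M * δ) ^ k + q` for `N`; the `+ 1` avoids a zero
  -- denominator when `k > n`.
  refine le_lowerMinkowskiDim (c := (p - q) / ((n.choose k + 1) * M ^ k)) (by positivity)
    fun δ hδ => ?_
  have h1 := measure_mem_inter_count_le hind hG hM hGM hS k hδ
  have h2 : ENNReal.ofReal p ≤
      ENNReal.ofReal (coveringNumber S δ * (n.choose k * (M * δ) ^ k) + q) := by
    rw [ENNReal.ofReal_add (by positivity) hq]
    refine hp.trans (le_trans ?_ (add_le_add h1 hcount))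
    refine (measure_mono fun ω hω => ?_).trans (measure_union_le _ _)
    by_cases h : (k : ℝ) ≤ ∑ i, (G i).indicator (1 : ℝ → ℝ) (x ω i)
    · exact Or.inl ⟨hω, h⟩
    · exact Or.inr h
  have h3 := (ENNReal.ofReal_le_ofReal_iff (by positivity)).1 h2
  have h4 : (0 : ℝ) ≤ coveringNumber S δ * (M * δ) ^ k := by positivity
  rw [one_div, inv_pow, ← div_eq_mul_inv, div_div, div_le_iff₀ (by positivity)]
  rw [mul_pow] at h3 h4
  linarith

/-! ### Upper bound: sparse boxes -/

theorem exists_finset_cover_abs_le {R δ : ℝ} (hR : 0 ≤ R) (hδ : 0 < δ) :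
    ∃ D : Finset ℝ, (∀ x, |x| ≤ R → ∃ d ∈ D, |x - d| < δ) ∧ (D.card : ℝ) ≤ 2 * R / δ + 1 := by
  refine ⟨(Finset.range (⌊2 * R / δ⌋₊ + 1)).image fun j : ℕ => -R + j * δ, fun x hx => ?_, ?_⟩
  · obtain ⟨h1, h2⟩ := abs_le.1 hx
    have h3 : 0 ≤ (x + R) / δ := div_nonneg (by linarith) hδ.le
    refine ⟨_, Finset.mem_image_of_mem _ (Finset.mem_range.2 (Nat.lt_succ_of_le
      (Nat.floor_le_floor (show (x + R) / δ ≤ 2 * R / δ by gcongr; linarith)))), ?_⟩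
    have h4 := Nat.floor_le h3
    have h5 := Nat.lt_floor_add_one ((x + R) / δ)
    rw [le_div_iff₀ hδ] at h4
    rw [div_lt_iff₀ hδ] at h5
    rw [abs_lt]
    constructor <;> linarith
  · refine (Nat.cast_le.2 Finset.card_image_le).trans ?_
    rw [Finset.card_range]
    push_cast
    linarith [Nat.floor_le (show 0 ≤ 2 * R / δ by positivity)]

theorem dist_lt_of_forall_abs_sub_lt {n : ℕ} {x y : EuclideanSpace ℝ (Fin n)} {δ : ℝ} (hδ : 0 < δ)
    (h : ∀ i, |x i - y i| < δ / (n + 1)) : dist x y < δ := by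
  -- The claim reduces to `n / (n + 1) ^ 2 < 1`, which also covers `n = 0`.
  rw [EuclideanSpace.dist_eq, Real.sqrt_lt' hδ]
  have h1 : ∑ i, dist (x i) (y i) ^ 2 ≤ ∑ _i : Fin n, (δ / (n + 1)) ^ 2 :=
    Finset.sum_le_sum fun i _ => pow_le_pow_left₀ dist_nonneg (h i).le 2
  refine h1.trans_lt ?_
  rw [Finset.sum_const, Finset.card_univ, Fintype.card_fin, nsmul_eq_mul, div_pow, ← mul_div_assoc,
    div_lt_iff₀ (by positivity)]
  have hn : (0 : ℝ) ≤ n := by positivity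
  nlinarith [pow_pos hδ 2, mul_nonneg hn hn]

/-- The vectors in a cube with at most `k` coordinates outside given finite sets. -/
def sparseBox {n : ℕ} (F : Fin n → Finset ℝ) (R : ℝ) (k : ℕ) : Set (EuclideanSpace ℝ (Fin n)) :=
  {x | (∀ i, |x i| ≤ R) ∧ ∑ i, ((F i : Set ℝ)ᶜ).indicator (1 : ℝ → ℝ) (x i) ≤ k}

theorem isBounded_sparseBox {n : ℕ} (F : Fin n → Finset ℝ) (R : ℝ) (k : ℕ) :
    Bornology.IsBounded (sparseBox F R k) := by
  refine isBounded_iff_forall_norm_le.2 ⟨√(∑ _i : Fin n, R ^ 2), fun x hx => ?_⟩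
  rw [EuclideanSpace.norm_eq]
  exact Real.sqrt_le_sqrt (Finset.sum_le_sum fun i _ =>
    pow_le_pow_left₀ (norm_nonneg _) (hx.1 i) 2)

theorem measurableSet_sparseBox {n : ℕ} (F : Fin n → Finset ℝ) (R : ℝ) (k : ℕ) :
    MeasurableSet (sparseBox F R k) := by
  have hc : ∀ i, Measurable fun x : EuclideanSpace ℝ (Fin n) => x i := fun i => by fun_prop
  have h1 : MeasurableSet {x : EuclideanSpace ℝ (Fin n) | ∀ i, |x i| ≤ R} := by
    rw [Set.ofPred_forall]
    exact MeasurableSet.iInter fun i => measurableSet_le (hc i).abs measurable_const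
  refine h1.inter (measurableSet_le (f := fun x : EuclideanSpace ℝ (Fin n) =>
    ∑ i, ((F i : Set ℝ)ᶜ).indicator (1 : ℝ → ℝ) (x i)) ?_ measurable_const)
  · refine Finset.measurable_sum _ fun i _ => ?_
    exact (measurable_one.indicator (F i).measurableSet.compl).comp (hc i)

/-- Once the set `T` of exceptional coordinates is fixed, those in `T` range over a grid with `O(1 /
δ)` points and the others over fixed finite sets. There are at most `2 ^ n` choices of `T`,
independently of `δ`. -/
theorem upperMinkowskiDim_sparseBox_le {n : ℕ} (F : Fin n → Finset ℝ) {R : ℝ} (hR : 0 ≤ R)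
    (k : ℕ) : upperMinkowskiDim (sparseBox F R k) ≤ k := by
  classical
  -- One constant serves both kinds of coordinate: it bounds every `(F i).card`, and `K / δ` bounds
  -- the grid of mesh `δ / (n + 1)`.
  set K : ℝ := 2 * R * (n + 1) + 1 + ∑ i, ((F i).card : ℝ)
  have hs : 0 ≤ ∑ i, ((F i).card : ℝ) := Finset.sum_nonneg fun i _ => Nat.cast_nonneg _
  have hRn : 0 ≤ 2 * R * (n + 1) := by positivity
  have hK1 : 1 ≤ K := by linarith
  have hK0 : 0 < K := by linarith
  have hFK : ∀ i, ((F i).card : ℝ) ≤ K := fun i => by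
    have := Finset.single_le_sum (f := fun i => ((F i).card : ℝ))
      (fun i _ => Nat.cast_nonneg _) (Finset.mem_univ i)
    linarith
  have hRK : 2 * R * (n + 1) + 1 ≤ K := by linarith
  clear_value K
  refine upperMinkowskiDim_le (c := 2 ^ n * K ^ n)
    (one_le_mul_of_one_le_of_one_le (one_le_pow₀ one_le_two) (one_le_pow₀ hK1))
    fun δ hδ hδ1 => ?_
  have hδi : 1 ≤ 1 / δ := by rw [le_div_iff₀ hδ]; linarith
  have hn1 : (0 : ℝ) < n + 1 := by positivity
  obtain ⟨D, hD, hDc⟩ := exists_finset_cover_abs_le hR (div_pos hδ hn1)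
  let E : Finset (Fin n) → Finset (Fin n → ℝ) := fun T =>
    Fintype.piFinset fun i => if i ∈ T then D else F i
  let U : Finset (Finset (Fin n)) := Finset.univ.filter fun T => T.card ≤ k
  have hcover : sparseBox F R k ⊆
      ⋃ y ∈ (U.biUnion E).image (WithLp.toLp 2), Metric.ball y δ := by
    rintro x ⟨hxR, hxk⟩
    let T : Finset (Fin n) := Finset.univ.filter fun i => x i ∉ F i
    have hT : T ∈ U := by
      have : ∑ i, ((F i : Set ℝ)ᶜ).indicator (1 : ℝ → ℝ) (x i) = (T.card : ℝ) := by
        simp [T, Set.indicator_apply, Finset.sum_ite, Finset.filter_not]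
      rw [this] at hxk
      exact Finset.mem_filter.2 ⟨Finset.mem_univ _, by exact_mod_cast hxk⟩
    have hi : ∀ i, ∃ d ∈ (if i ∈ T then D else F i), |x i - d| < δ / (n + 1) := by
      intro i
      by_cases h : x i ∈ F i
      · have : i ∉ T := by simp [T, h]
        rw [if_neg this]
        exact ⟨x i, h, by rw [sub_self, abs_zero]; positivity⟩
      · have : i ∈ T := by simp [T, h]
        rw [if_pos this]
        exact hD _ (hxR i)
    choose d hd hxd using hi
    refine Set.mem_iUnion₂.2 ⟨WithLp.toLp 2 d, Finset.mem_image_of_mem _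
      (Finset.mem_biUnion.2 ⟨T, hT, Fintype.mem_piFinset.2 hd⟩), ?_⟩
    exact dist_lt_of_forall_abs_sub_lt hδ hxd
  have hE : ∀ T ∈ U, ((E T).card : ℝ) ≤ K ^ n * (1 / δ) ^ k := by
    intro T hT
    have hTk : T.card ≤ k := (Finset.mem_filter.1 hT).2
    have hDK : (D.card : ℝ) ≤ K * (1 / δ) := by
      calc (D.card : ℝ) ≤ 2 * R * (n + 1) * (1 / δ) + 1 := by
            refine hDc.trans_eq ?_
            field_simp
        _ ≤ K * (1 / δ) := by nlinarith
    calc ((E T).card : ℝ) = ∏ i, (((if i ∈ T then D else F i).card : ℕ) : ℝ) := by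
          simp only [E, Fintype.card_piFinset, Nat.cast_prod]
      _ ≤ ∏ i, (K * if i ∈ T then 1 / δ else 1) := by
          refine Finset.prod_le_prod (fun i _ => Nat.cast_nonneg _) fun i _ => ?_
          split_ifs
          · exact hDK
          · rw [mul_one]; exact hFK i
      _ = K ^ n * (1 / δ) ^ T.card := by
          rw [Finset.prod_mul_distrib, Finset.prod_ite_mem]
          simp
      _ ≤ K ^ n * (1 / δ) ^ k := mul_le_mul_of_nonneg_left (pow_le_pow_right₀ hδi hTk) (by positivity)
  have h1 : (coveringNumber (sparseBox F R k) δ : ℝ) ≤ ∑ T ∈ U, ((E T).card : ℝ) := by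
    exact_mod_cast (coveringNumber_le_card _ hcover).trans
      (Finset.card_image_le.trans Finset.card_biUnion_le)
  refine h1.trans ((Finset.sum_le_card_nsmul _ _ _ hE).trans ?_)
  have hU : (U.card : ℝ) ≤ 2 ^ n := by
    have : U.card ≤ 2 ^ n := (Finset.card_filter_le _ _).trans (by simp)
    exact_mod_cast this
  rw [nsmul_eq_mul, mul_assoc]
  exact mul_le_mul_of_nonneg_right hU (by positivity)

theorem exists_measureReal_lt_abs_le {Ω : Type*} [MeasurableSpace Ω] {P : Measure Ω}
    [IsProbabilityMeasure P] {n : ℕ} {x : Ω → EuclideanSpace ℝ (Fin n)} (hx : Measurable x)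
    {η : ℝ} (hη : 0 < η) :
    ∃ R : ℝ, 0 ≤ R ∧ P.real {ω | ¬ ∀ i, |x ω i| ≤ R} ≤ η := by
  let A : ℕ → Set Ω := fun m => {ω | ‖x ω‖ ≤ m}
  have hA : ∀ m, MeasurableSet (A m) := fun m => measurableSet_le hx.norm measurable_const
  have hmono : Monotone A := fun m m' hmm ω hω =>
    le_trans (b := (m : ℝ)) hω (by exact_mod_cast hmm)
  have hunion : ⋃ m, A m = Set.univ := Set.eq_univ_of_forall fun ω =>
    Set.mem_iUnion.2 (exists_nat_ge ‖x ω‖)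
  have hlim : Tendsto (fun m => P.real (A m)) atTop (𝓝 1) := by
    have := tendsto_measure_iUnion_atTop (μ := P) hmono
    rw [hunion, measure_univ] at this
    exact (ENNReal.tendsto_toReal ENNReal.one_ne_top).comp this
  obtain ⟨m, hm⟩ := (hlim.eventually (lt_mem_nhds (show 1 - η < 1 by linarith))).exists
  refine ⟨m, m.cast_nonneg, ?_⟩
  have hsub : {ω | ¬ ∀ i, |x ω i| ≤ m} ⊆ (A m)ᶜ := fun ω hω h =>
    hω fun i => (PiLp.norm_apply_le (x ω) i).trans h
  refine (measureReal_mono hsub).trans ?_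
  rw [probReal_compl_eq_one_sub (hA m)]
  linarith

/-! ### The mean count for the concatenated source -/

theorem numZ_le {lam : ℝ} (hlam : lam ∈ Set.Icc (0 : ℝ) 1) (n : ℕ) : numZ lam n ≤ n := by
  refine Nat.floor_le_of_le ?_
  have : (0 : ℝ) ≤ n := n.cast_nonneg
  nlinarith [hlam.2]

theorem sum_ite_lt {n l : ℕ} (hl : l ≤ n) (a b : ℝ) :
    ∑ i : Fin n, (if (i : ℕ) < n - l then a else b) = ((n : ℝ) - l) * a + l * b := by
  obtain ⟨m, rfl⟩ := Nat.exists_eq_add_of_le' hl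
  rw [Fin.sum_univ_add]
  simp

/-- Replacing `⌊lam * n⌋₊` by `lam * n` costs at most `ρ₂ ≤ 1`; the truncation costs at most `η` per
coordinate. -/
theorem le_sum_ite_numZ {lam : ℝ} (hlam : lam ∈ Set.Icc (0 : ℝ) 1) {ρ₁ ρ₂ η a b : ℝ}
    (h1 : 0 ≤ ρ₁) (h2 : ρ₂ ≤ 1) (ha : ρ₁ - η ≤ a) (hb : ρ₂ - η ≤ b) (h2' : 0 ≤ ρ₂) (n : ℕ) :
    n * ((1 - lam) * ρ₁ + lam * ρ₂) - 1 - n * η ≤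
      ∑ i : Fin n, (if (i : ℕ) < n - numZ lam n then a else b) := by
  have hl := numZ_le hlam n
  rw [sum_ite_lt hl]
  have hl' : (numZ lam n : ℝ) ≤ n := by exact_mod_cast hl
  have hf : (numZ lam n : ℝ) ≤ lam * n := Nat.floor_le (mul_nonneg hlam.1 n.cast_nonneg)
  have hf' : lam * n < numZ lam n + 1 := Nat.lt_floor_add_one _
  have e1 := mul_le_mul_of_nonneg_left ha (sub_nonneg.2 hl')
  have e2 := mul_le_mul_of_nonneg_left hb (Nat.cast_nonneg (α := ℝ) (numZ lam n))
  nlinarith [mul_nonneg (sub_nonneg.2 hf) h1, mul_nonneg (sub_nonneg.2 hf'.le) h2']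

theorem sum_ite_numZ_le {lam : ℝ} (hlam : lam ∈ Set.Icc (0 : ℝ) 1) {ρ₁ ρ₂ η a b : ℝ}
    (h1 : 0 ≤ ρ₁) (h1' : ρ₁ ≤ 1) (h2 : 0 ≤ ρ₂) (ha : a ≤ ρ₁ + η) (hb : b ≤ ρ₂ + η) (n : ℕ) :
    ∑ i : Fin n, (if (i : ℕ) < n - numZ lam n then a else b) ≤
      n * ((1 - lam) * ρ₁ + lam * ρ₂) + 1 + n * η := by
  have hl := numZ_le hlam n
  rw [sum_ite_lt hl]
  have hl' : (numZ lam n : ℝ) ≤ n := by exact_mod_cast hl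
  have hf : (numZ lam n : ℝ) ≤ lam * n := Nat.floor_le (mul_nonneg hlam.1 n.cast_nonneg)
  have hf' : lam * n < numZ lam n + 1 := Nat.lt_floor_add_one _
  have e1 := mul_le_mul_of_nonneg_left ha (sub_nonneg.2 hl')
  have e2 := mul_le_mul_of_nonneg_left hb (Nat.cast_nonneg (α := ℝ) (numZ lam n))
  nlinarith [mul_nonneg (sub_nonneg.2 hf) h2, mul_nonneg (sub_nonneg.2 hf'.le) h1]

variable {Ω : Type*} [MeasurableSpace Ω]

theorem measurable_concatSource_apply {Y Z : ℕ → Ω → ℝ} (hY : ∀ i, Measurable (Y i))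
    (hZ : ∀ i, Measurable (Z i)) (lam : ℝ) (n : ℕ) (i : Fin n) :
    Measurable fun ω => concatSource lam Y Z n ω i := by
  simp only [concatSource]
  split_ifs
  · exact hY _
  · exact hZ _

theorem measurable_concatSource {Y Z : ℕ → Ω → ℝ} (hY : ∀ i, Measurable (Y i))
    (hZ : ∀ i, Measurable (Z i)) (lam : ℝ) (n : ℕ) : Measurable (concatSource lam Y Z n) :=
  (WithLp.measurable_toLp 2 (Fin n → ℝ)).comp
    (measurable_pi_lambda _ fun i => measurable_concatSource_apply hY hZ lam n i)

/-! ### Asymptotic bounds and the rate -/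

/-- For large `n`, every approximate support has normalized lower dimension almost at least the
mean mixture parameter. -/
theorem eventually_le_lowerMinkowskiDim_div (P : Measure Ω) [IsProbabilityMeasure P]
    {Y Z : ℕ → Ω → ℝ} (hY : ∀ i, Measurable (Y i)) (hZ : ∀ i, Measurable (Z i))
    {lam : ℝ} (hlam : lam ∈ Set.Icc (0 : ℝ) 1) {ρ₁ ρ₂ : ℝ} (hmixed : IsMixedSource P lam ρ₁ ρ₂ Y Z)
    {ε : ℝ} (hε : ε < 1) {η : ℝ} (hη : 0 < η) :
    ∀ᶠ n : ℕ in atTop, ∀ S ∈ approxSupports P (concatSource lam Y Z n) ε,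
      (((1 - lam) * ρ₁ + lam * ρ₂ - 4 * η : ℝ) : EReal) ≤ lowerMinkowskiDim S / (n : EReal) := by
  obtain ⟨μ₁, μ₂, hμ₁, hμ₂, hlaw⟩ := hmixed
  obtain ⟨G₁, M₁, hG₁, hM₁, hGρ₁, hball₁⟩ := hμ₁.exists_bounded_density hη
  obtain ⟨G₂, M₂, hG₂, hM₂, hGρ₂, hball₂⟩ := hμ₂.exists_bounded_density hη
  have hlim : Tendsto (fun n : ℕ => (n : ℝ)) atTop atTop := tendsto_natCast_atTop_atTop
  -- The second condition gives `1 ≤ n * η`, which absorbs rounding errors; the third makes the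
  -- Chebyshev bound `n / (n * η) ^ 2` at most `(1 - ε) / 2`.
  filter_upwards [hlim.eventually_gt_atTop 0, hlim.eventually_ge_atTop (1 / η),
    hlim.eventually_ge_atTop (1 / ((1 - ε) / 2) / η ^ 2)] with n hn0 hn1 hn2 S hS
  obtain ⟨-, hSb, -, hSP⟩ := hS
  obtain ⟨hind, hmap⟩ := hlaw n
  have hX := measurable_concatSource_apply hY hZ lam n
  have hnη : 1 ≤ n * η := by rwa [div_le_iff₀ hη] at hn1
  have hε2 : 0 < (1 - ε) / 2 := by linarith
  set r : ℝ := (1 - lam) * ρ₁ + lam * ρ₂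
  let G : Fin n → Set ℝ := fun i => if (i : ℕ) < n - numZ lam n then G₁ else G₂
  have hG : ∀ i, MeasurableSet (G i) := fun i => by
    simp only [G]
    split_ifs
    · exact hG₁
    · exact hG₂
  have hGP : ∀ i, P.real ((fun ω => concatSource lam Y Z n ω i) ⁻¹' G i) =
      if (i : ℕ) < n - numZ lam n then μ₁.real G₁ else μ₂.real G₂ := by
    intro i
    rw [← map_measureReal_apply (hX i) (hG i), hmap i]
    simp only [G]
    split_ifs <;> rfl
  have hGM : ∀ i a δ, 0 < δ →
      P ((fun ω => concatSource lam Y Z n ω i) ⁻¹' (G i ∩ Metric.ball a δ)) ≤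
        ENNReal.ofReal (max M₁ M₂ * δ) := by
    intro i a δ hδ
    rw [← Measure.map_apply (hX i) ((hG i).inter measurableSet_ball), hmap i]
    simp only [G]
    split_ifs
    · exact (hball₁ a δ hδ).trans (ENNReal.ofReal_le_ofReal (by gcongr; exact le_max_left _ _))
    · exact (hball₂ a δ hδ).trans (ENNReal.ofReal_le_ofReal (by gcongr; exact le_max_right _ _))
  have hmean := le_sum_ite_numZ hlam hμ₁.1 hμ₂.2.1 hGρ₁ hGρ₂ hμ₂.1 n
  have hdev := measure_count_deviation_le hX hind hG (t := n * η) (by positivity)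
  simp only [hGP] at hdev
  -- The `3 * η` pays for the truncation, the rounding of `ℓ` and the deviation; the floor accounts
  -- for the fourth `η`.
  have hcount : P {ω | ¬ ((⌊n * (r - 3 * η)⌋₊ : ℕ) : ℝ) ≤
      ∑ i, (G i).indicator (1 : ℝ → ℝ) (concatSource lam Y Z n ω i)} ≤
      ENNReal.ofReal ((1 - ε) / 2) := by
    refine (measure_mono fun ω hω => ?_).trans (hdev.trans (ENNReal.ofReal_le_ofReal ?_))
    · have hω' : ¬ ((⌊n * (r - 3 * η)⌋₊ : ℕ) : ℝ) ≤
        ∑ i, (G i).indicator (1 : ℝ → ℝ) (concatSource lam Y Z n ω i) := hω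
      have hpos : 0 ≤ ∑ i, (G i).indicator (1 : ℝ → ℝ) (concatSource lam Y Z n ω i) :=
        Finset.sum_nonneg fun i _ => Set.indicator_nonneg (fun _ _ => zero_le_one) _
      -- If this were negative the natural floor would be `0`, and no count falls below `0`.
      have hle : 0 ≤ n * (r - 3 * η) := by
        by_contra h
        rw [Nat.floor_of_nonpos (not_le.1 h).le, Nat.cast_zero] at hω'
        exact hω' hpos
      have := Nat.floor_le hle
      refine le_trans (b := -(_ : ℝ)) ?_ (neg_le_abs _)
      linarith
    · rw [div_div, div_le_iff₀ (by positivity)] at hn2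
      rw [div_le_iff₀ (by positivity)]
      nlinarith
  have hk := le_lowerMinkowskiDim_of_measure hind hG (lt_max_of_lt_left hM₁) hGM hSb hε2.le
    (by linarith) hSP hcount
  have hn0' : (0 : EReal) < n := by exact_mod_cast hn0
  rw [EReal.le_div_iff_mul_le hn0' (EReal.natCast_ne_top n)]
  refine le_trans ?_ hk
  rw [← EReal.coe_natCast, ← EReal.coe_natCast, ← EReal.coe_mul, EReal.coe_le_coe_iff]
  have := Nat.lt_floor_add_one (n * (r - 3 * η))
  linarith

/-- For large `n`, some approximate support has normalized upper dimension at most about the mean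
mixture parameter. -/
theorem eventually_exists_upperMinkowskiDim_div_le (P : Measure Ω) [IsProbabilityMeasure P]
    {Y Z : ℕ → Ω → ℝ} (hY : ∀ i, Measurable (Y i)) (hZ : ∀ i, Measurable (Z i))
    {lam : ℝ} (hlam : lam ∈ Set.Icc (0 : ℝ) 1) {ρ₁ ρ₂ : ℝ} (hmixed : IsMixedSource P lam ρ₁ ρ₂ Y Z)
    {ε : ℝ} (hε : ε ∈ Set.Ioo (0 : ℝ) 1) {η : ℝ} (hη : 0 < η) :
    ∀ᶠ n : ℕ in atTop, ∃ S ∈ approxSupports P (concatSource lam Y Z n) ε,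
      upperMinkowskiDim S / (n : EReal) ≤ (((1 - lam) * ρ₁ + lam * ρ₂ + 4 * η : ℝ) : EReal) := by
  obtain ⟨hε0, hε1⟩ := hε
  obtain ⟨μ₁, μ₂, hμ₁, hμ₂, hlaw⟩ := hmixed
  obtain ⟨F₁, hF₁⟩ := hμ₁.exists_finset hη
  obtain ⟨F₂, hF₂⟩ := hμ₂.exists_finset hη
  have hlim : Tendsto (fun n : ℕ => (n : ℝ)) atTop atTop := tendsto_natCast_atTop_atTop
  filter_upwards [hlim.eventually_gt_atTop 0, hlim.eventually_ge_atTop (1 / η),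
    hlim.eventually_ge_atTop (1 / (ε / 2) / η ^ 2)] with n hn0 hn1 hn2
  obtain ⟨hind, hmap⟩ := hlaw n
  have hX := measurable_concatSource_apply hY hZ lam n
  have hx := measurable_concatSource hY hZ lam n
  have hnη : 1 ≤ n * η := by rwa [div_le_iff₀ hη] at hn1
  have hr : 0 ≤ (1 - lam) * ρ₁ + lam * ρ₂ :=
    add_nonneg (mul_nonneg (by linarith [hlam.2]) hμ₁.1) (mul_nonneg hlam.1 hμ₂.1)
  set r : ℝ := (1 - lam) * ρ₁ + lam * ρ₂
  let F : Fin n → Finset ℝ := fun i => if (i : ℕ) < n - numZ lam n then F₁ else F₂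
  have hF : ∀ i, MeasurableSet (F i : Set ℝ)ᶜ := fun i => (F i).measurableSet.compl
  have hFP : ∀ i, P.real ((fun ω => concatSource lam Y Z n ω i) ⁻¹' (F i : Set ℝ)ᶜ) =
      if (i : ℕ) < n - numZ lam n then μ₁.real (F₁ : Set ℝ)ᶜ else μ₂.real (F₂ : Set ℝ)ᶜ := by
    intro i
    rw [← map_measureReal_apply (hX i) (hF i), hmap i]
    simp only [F]
    split_ifs <;> rfl
  obtain ⟨R, hR0, hR⟩ := exists_measureReal_lt_abs_le (P := P) hx (half_pos hε0)
  -- Same budget as in the lower bound, with the ceiling taking the fourth `η`. The allowed failure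
  -- `ε` is split equally between leaving the cube and having too many exceptional coordinates.
  let k : ℕ := ⌈n * (r + 3 * η)⌉₊
  have hmean := sum_ite_numZ_le hlam hμ₁.1 hμ₁.2.1 hμ₂.1 hF₁ hF₂ n
  have hdev := measure_count_deviation_le hX hind hF (t := n * η) (by positivity)
  simp only [hFP] at hdev
  have hcount : P.real {ω | ¬ ∑ i, ((F i : Set ℝ)ᶜ).indicator (1 : ℝ → ℝ)
      (concatSource lam Y Z n ω i) ≤ (k : ℝ)} ≤ ε / 2 := by
    refine ENNReal.toReal_le_of_le_ofReal (half_pos hε0).le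
      ((measure_mono fun ω hω => ?_).trans (hdev.trans (ENNReal.ofReal_le_ofReal ?_)))
    · have hω' : (k : ℝ) < ∑ i, ((F i : Set ℝ)ᶜ).indicator (1 : ℝ → ℝ)
        (concatSource lam Y Z n ω i) := not_le.1 hω
      have : n * (r + 3 * η) ≤ (k : ℝ) := Nat.le_ceil _
      refine le_trans (b := (_ : ℝ)) ?_ (le_abs_self _)
      linarith
    · rw [div_div, div_le_iff₀ (by positivity)] at hn2
      rw [div_le_iff₀ (by positivity)]
      nlinarith
  have hSm := measurableSet_sparseBox F R k
  have hSP : 1 - ε ≤ P.real (concatSource lam Y Z n ⁻¹' sparseBox F R k) := by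
    have h1 : P.real (concatSource lam Y Z n ⁻¹' sparseBox F R k)ᶜ ≤ ε := by
      calc P.real (concatSource lam Y Z n ⁻¹' sparseBox F R k)ᶜ
          ≤ P.real ({ω | ¬ ∀ i, |concatSource lam Y Z n ω i| ≤ R} ∪
              {ω | ¬ ∑ i, ((F i : Set ℝ)ᶜ).indicator (1 : ℝ → ℝ)
                (concatSource lam Y Z n ω i) ≤ (k : ℝ)}) :=
            measureReal_mono fun ω hω => not_and_or.1 hω
        _ ≤ ε / 2 + ε / 2 := (measureReal_union_le _ _).trans (add_le_add hR hcount)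
        _ = ε := add_halves ε
    rw [probReal_compl_eq_one_sub (hx hSm)] at h1
    linarith
  refine ⟨sparseBox F R k, ⟨?_, isBounded_sparseBox F R k, hSm, ?_⟩, ?_⟩
  -- Nonemptiness comes from positive probability, using `ε < 1`.
  · have : (concatSource lam Y Z n ⁻¹' sparseBox F R k).Nonempty := by
      rw [Set.nonempty_iff_ne_empty]
      intro h
      rw [h, measureReal_empty] at hSP
      linarith
    obtain ⟨ω, hω⟩ := this
    exact ⟨_, hω⟩
  · exact ENNReal.ofReal_le_of_le_toReal hSP
  · have hn0' : (0 : EReal) < n := by exact_mod_cast hn0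
    rw [EReal.div_le_iff_le_mul hn0' (EReal.natCast_ne_top n)]
    refine (upperMinkowskiDim_sparseBox_le F hR0 k).trans ?_
    rw [← EReal.coe_natCast, ← EReal.coe_natCast, ← EReal.coe_mul, EReal.coe_le_coe_iff]
    have : (k : ℝ) < n * (r + 3 * η) + 1 := Nat.ceil_lt_add_one (by positivity)
    linarith

theorem lowerMinkowskiRate_le_upperMinkowskiRate (P : Measure Ω)
    (x : (n : ℕ) → Ω → EuclideanSpace ℝ (Fin n)) (ε : ℝ) :
    lowerMinkowskiRate P x ε ≤ upperMinkowskiRate P x ε := by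
  refine limsup_le_limsup (Eventually.of_forall fun n => iInf₂_mono fun S _ => ?_)
  exact EReal.div_le_div_right_of_nonneg (by positivity)
    (lowerMinkowskiDim_le_upperMinkowskiDim S)

end SignalSeparation

theorem proposition3 {Ω : Type*} [MeasurableSpace Ω] (P : Measure Ω) [IsProbabilityMeasure P]
    (Y Z : ℕ → Ω → ℝ) (hY : ∀ i, Measurable (Y i)) (hZ : ∀ i, Measurable (Z i))
    (lam : ℝ) (hlam : lam ∈ Set.Icc (0 : ℝ) 1) (ρ₁ ρ₂ : ℝ)
    (hmixed : SignalSeparation.IsMixedSource P lam ρ₁ ρ₂ Y Z)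
    (ε : ℝ) (hε : ε ∈ Set.Ioo (0 : ℝ) 1) :
    SignalSeparation.IsMinkowskiRate P (SignalSeparation.concatSource lam Y Z) ε
      ((1 - lam) * ρ₁ + lam * ρ₂) := by
  have hlower : (((1 - lam) * ρ₁ + lam * ρ₂ : ℝ) : EReal) ≤
      SignalSeparation.lowerMinkowskiRate P (SignalSeparation.concatSource lam Y Z) ε := by
    -- It suffices to beat every real `z` below the target; `η` is a quarter of the gap because the
    -- bound loses `4 * η`.
    refine EReal.ge_of_forall_gt_iff_ge.1 fun z hz => ?_
    have hz' : z < (1 - lam) * ρ₁ + lam * ρ₂ := EReal.coe_lt_coe_iff.1 hz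
    have h := SignalSeparation.eventually_le_lowerMinkowskiDim_div P hY hZ hlam hmixed hε.2
      (η := ((1 - lam) * ρ₁ + lam * ρ₂ - z) / 4) (by linarith)
    refine le_limsup_of_frequently_le (Eventually.frequently ?_) (by isBoundedDefault)
    filter_upwards [h] with n hn
    refine le_iInf₂ fun S hS => (EReal.coe_le_coe_iff.2 ?_).trans (hn S hS)
    linarith
  have hupper : SignalSeparation.upperMinkowskiRate P (SignalSeparation.concatSource lam Y Z) ε ≤
      (((1 - lam) * ρ₁ + lam * ρ₂ : ℝ) : EReal) := by
    refine EReal.le_of_forall_lt_iff_le.1 fun z hz => ?_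
    have hz' : (1 - lam) * ρ₁ + lam * ρ₂ < z := EReal.coe_lt_coe_iff.1 hz
    have h := SignalSeparation.eventually_exists_upperMinkowskiDim_div_le P hY hZ hlam hmixed hε
      (η := (z - ((1 - lam) * ρ₁ + lam * ρ₂)) / 4) (by linarith)
    refine limsup_le_of_le (by isBoundedDefault) ?_
    filter_upwards [h] with n hn
    obtain ⟨S, hS, hSn⟩ := hn
    refine (iInf₂_le S hS).trans (hSn.trans (EReal.coe_le_coe_iff.2 ?_))
    linarith
  have hle := SignalSeparation.lowerMinkowskiRate_le_upperMinkowskiRate P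
    (SignalSeparation.concatSource lam Y Z) ε
  exact ⟨le_antisymm (hle.trans hupper) hlower, le_antisymm hupper (hlower.trans hle)⟩
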